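/- Let $k>0$ and $\lambda\in\mathbb R$, $\lambda\neq 0$. For $w\in\mathbb C$ let $z\mapsto E_k(z,w)$ be the one-dimensional Dunkl kernel, i.e. the unique entire function $f$ with $f(0)=1$ and $$f'(z)+k\,\frac{f(z)-f(-z)}{z}=w\,f(z)\qquad(z\neq0),$$ and put $c_k:=\frac{1}{2^{k+1/2}\,\Gamma(k+1/2)}$. A one-dimensional Dunkl process with multiplicity $k$, drift $\lambda$ and start in $0$ is a real-valued Markov process $(X_t)_{t\ge0}$ with $X_0=0$ almost surely whose transition kernels are, for $t>0$, $x\in\mathbb R$ and Borel sets $A\subset\mathbb R$, $$K_t(x,A)=\frac{c_k\,e^{-\lambda^2t/2}}{t^{k+1/2}}\int_A e^{-(x^2+y^2)/(2t)}\,\frac{E_k\big(\tfrac{x}{\sqrt t},\tfrac{y}{\sqrt t}\big)\,E_k(y,\lambda)}{E_k(x,\lambda)}\,|y|^{2k}\,dy .$$ Theorem. Let $(X_t)_{t\ge0}$ be a one-dimensional Dunkl process with multiplicity $k>0$, drift $\lambda\ne0$ and start in $0$. Then $(X_t-t\lambda)/\sqrt t$ converges in distribution to the standard normal distribution $N(0,1)$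 as $t\to\infty$. Moreover, for every $t>0$ the random variable $(X_t-t\lambda)/\sqrt t$ has the Lebesgue density $$\phi_t(y)=c_k\,\frac{e^{-\lambda^2t/2}}{t^{k}}\,e^{-(y\sqrt t+\lambda t)^2/(2t)}\,E_k(y\sqrt t+\lambda t,\lambda)\,|y\sqrt t+\lambda t|^{2k}\qquad(y\in\mathbb R),$$ and $\phi_t(y)\to\frac1{\sqrt{2\pi}}e^{-y^2/2}$ as $t\to\infty$, locally uniformly in $y\in\mathbb R$. -/

import Mathlib

open MeasureTheory ProbabilityTheory Filter Topology
open scoped NNReal ENNReal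

noncomputable section

/-- The rank-one Dunkl operator `T(k)` of the root system `{1, -1}` (positive root `1`,
reflection `z ↦ -z`), acting on functions of one complex variable; evaluated at `z ≠ 0`. -/
def dunklOperator (k : ℝ) (f : ℂ → ℂ) (z : ℂ) : ℂ :=
  deriv f z + (k : ℂ) * ((f z - f (-z)) / z)

/-- `f` is a holomorphic solution of the eigenvalue problem `T(k) f = w f`, `f 0 = 1`
(at `z = 0` the equation holds by continuity). -/
structure IsDunklEigenfunction (k : ℝ) (w : ℂ) (f : ℂ → ℂ) : Prop where
  entire : Differentiable ℂ f
  eigen : ∀ z : ℂ, z ≠ 0 → dunklOperator k f z = w * f z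
  at_zero : f 0 = 1

/-- Two solutions of the eigenvalue problem agree. -/
theorem IsDunklEigenfunction.unique {k : ℝ} (hk : 0 ≤ k) {w : ℂ} {f g : ℂ → ℂ}
    (hf : IsDunklEigenfunction k w f) (hg : IsDunklEigenfunction k w g) : f = g := by
  have hd : Differentiable ℂ (fun z => f z - g z) := hf.entire.sub hg.entire
  have hall : AnalyticOnNhd ℂ (fun z => f z - g z) Set.univ := fun z _ => hd.analyticAt z
  have hfa : AnalyticOnNhd ℂ f Set.univ := fun z _ => hf.entire.analyticAt z
  have hga : AnalyticOnNhd ℂ g Set.univ := fun z _ => hg.entire.analyticAt z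
  by_contra hne
  have h0 : ¬ (∀ᶠ z in 𝓝 (0 : ℂ), f z - g z = 0) := by
    intro h
    exact hne (hfa.eq_of_eventuallyEq hga (h.mono fun z hz => sub_eq_zero.mp hz))
  obtain ⟨n, u, hu, hu0, hue⟩ :=
    (hall 0 (Set.mem_univ _)).exists_eventuallyEq_pow_smul_nonzero_iff.mpr h0
  simp only [sub_zero, smul_eq_mul] at hue
  have hn : n ≠ 0 := by
    rintro rfl
    have := hue.self_of_nhds
    simp [hf.at_zero, hg.at_zero] at this
    exact hu0 this.symm
  obtain ⟨m, rfl⟩ := Nat.exists_eq_add_one_of_ne_zero hn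
  -- the equation near zero
  have hderiv : ∀ᶠ z in 𝓝 (0 : ℂ), deriv (fun z => f z - g z) z
      = ((m + 1 : ℕ) : ℂ) * z ^ m * u z + z ^ (m + 1) * deriv u z := by
    filter_upwards [hue.eventually_nhds, hu.eventually_analyticAt] with z hz hza
    have hz' : (fun z => f z - g z) =ᶠ[𝓝 z] fun z => z ^ (m + 1) * u z := hz
    rw [hz'.deriv_eq]
    have h1 := (hasDerivAt_pow (m + 1) z).mul hza.differentiableAt.hasDerivAt
    have h2 : deriv (fun z => z ^ (m + 1) * u z) z
        = ((m + 1 : ℕ) : ℂ) * z ^ (m + 1 - 1) * u z + z ^ (m + 1) * deriv u z := h1.deriv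
    simpa using h2
  have hneg : Tendsto (fun z : ℂ => -z) (𝓝 0) (𝓝 0) := by
    simpa using (continuous_neg (G := ℂ)).tendsto 0
  have key : ∀ᶠ z in 𝓝[≠] (0 : ℂ),
      ((m + 1 : ℕ) : ℂ) * u z + z * deriv u z + k * (u z - (-1) ^ (m + 1) * u (-z))
        - w * z * u z = 0 := by
    filter_upwards [hderiv.filter_mono nhdsWithin_le_nhds, hue.filter_mono nhdsWithin_le_nhds,
      (hneg.eventually hue).filter_mono nhdsWithin_le_nhds, self_mem_nhdsWithin]
      with z h1 h2 h3 hz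
    have hz0 : z ≠ 0 := hz
    have e1 := hf.eigen z hz0
    have e2 := hg.eigen z hz0
    have hds : deriv (fun z => f z - g z) z = deriv f z - deriv g z :=
      deriv_fun_sub hf.entire.differentiableAt hg.entire.differentiableAt
    rw [hds] at h1
    unfold dunklOperator at e1 e2
    have e3 : (deriv f z - deriv g z) * z + k * ((f z - g z) - (f (-z) - g (-z)))
        = w * z * (f z - g z) := by
      field_simp at e1 e2
      linear_combination e1 - e2
    rw [h1, h2, h3, neg_pow z] at e3
    have hzm : z ^ (m + 1) ≠ 0 := pow_ne_zero _ hz0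
    apply mul_left_cancel₀ hzm
    rw [mul_zero]
    linear_combination e3
  have hcont : ContinuousAt (fun z : ℂ => ((m + 1 : ℕ) : ℂ) * u z + z * deriv u z
      + k * (u z - (-1) ^ (m + 1) * u (-z)) - w * z * u z) 0 := by
    have c1 : ContinuousAt u 0 := hu.continuousAt
    have c2 : ContinuousAt (deriv u) 0 := hu.deriv.continuousAt
    have c3 : ContinuousAt (fun z => u (-z)) 0 :=
      ContinuousAt.comp (by simpa using c1) continuous_neg.continuousAt
    exact (((continuousAt_const.mul c1).add (continuousAt_id.mul c2)).add
      (continuousAt_const.mul (c1.sub (continuousAt_const.mul c3)))).sub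
      ((continuousAt_const.mul continuousAt_id).mul c1)
  have hlim := (hcont.tendsto.mono_left nhdsWithin_le_nhds).congr' key
  have hz := tendsto_nhds_unique hlim tendsto_const_nhds
  simp only [neg_zero, zero_mul, mul_zero, add_zero, sub_zero] at hz
  have hfac : (((m + 1 : ℕ) : ℂ) + k * (1 - (-1) ^ (m + 1))) * u 0 = 0 := by
    linear_combination hz
  rcases mul_eq_zero.mp hfac with h | h
  · have hr : (((m + 1 : ℕ) : ℝ) + k * (1 - (-1) ^ (m + 1))) = 0 := by
      exact_mod_cast h
    have hp : (0 : ℝ) ≤ 1 - (-1) ^ (m + 1) := by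
      rcases neg_one_pow_eq_or ℝ (m + 1) with h | h <;> rw [h] <;> norm_num
    have : (0 : ℝ) < ((m + 1 : ℕ) : ℝ) := by positivity
    nlinarith [mul_nonneg hk hp]
  · exact hu0 h

/-- The recursively defined Taylor coefficients of the solution of the eigenvalue problem. -/
def dunklCoeff (k : ℝ) (w : ℂ) : ℕ → ℂ
  | 0 => 1
  | n + 1 => w / (((n + 1 : ℕ) : ℂ) + k * (1 - (-1) ^ (n + 1))) * dunklCoeff k w n

theorem dunklCoeff_norm_le {k : ℝ} (hk : 0 ≤ k) (w : ℂ) (n : ℕ) :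
    ‖dunklCoeff k w n‖ ≤ ‖w‖ ^ n / n.factorial := by
  induction n with
  | zero => simp [dunklCoeff]
  | succ n ih =>
    have hp : (0 : ℝ) ≤ 1 - (-1) ^ (n + 1) := by
      rcases neg_one_pow_eq_or ℝ (n + 1) with h | h <;> rw [h] <;> norm_num
    have hge : ((n + 1 : ℕ) : ℝ) ≤ ((n + 1 : ℕ) : ℝ) + k * (1 - (-1) ^ (n + 1)) := by
      nlinarith [mul_nonneg hk hp]
    have hpos : (0 : ℝ) < ((n + 1 : ℕ) : ℝ) := by positivity
    have hnorm : ‖(((n + 1 : ℕ) : ℂ) + k * (1 - (-1) ^ (n + 1)))‖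
        = ((n + 1 : ℕ) : ℝ) + k * (1 - (-1) ^ (n + 1)) := by
      have hc : (((n + 1 : ℕ) : ℂ) + k * (1 - (-1) ^ (n + 1)))
          = (((((n + 1 : ℕ) : ℝ) + k * (1 - (-1) ^ (n + 1)) : ℝ)) : ℂ) := by push_cast; ring
      rw [hc, Complex.norm_real, Real.norm_of_nonneg (hpos.le.trans hge)]
    rw [dunklCoeff, norm_mul, norm_div, hnorm]
    calc ‖w‖ / (((n + 1 : ℕ) : ℝ) + k * (1 - (-1) ^ (n + 1))) * ‖dunklCoeff k w n‖
        ≤ ‖w‖ / ((n + 1 : ℕ) : ℝ) * (‖w‖ ^ n / n.factorial) := by gcongr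
      _ = ‖w‖ ^ (n + 1) / (n + 1).factorial := by
        rw [Nat.factorial_succ]; push_cast; field_simp; ring

/-- The eigenvalue problem has a holomorphic solution, given by its Taylor series. -/
theorem isDunklEigenfunction_tsum {k : ℝ} (hk : 0 ≤ k) (w : ℂ) :
    IsDunklEigenfunction k w (fun z => ∑' n : ℕ, dunklCoeff k w n * z ^ n) := by
  have hsumm : ∀ R : ℝ, Summable fun n : ℕ => ‖dunklCoeff k w n‖ * |R| ^ n := by
    intro R
    refine Summable.of_nonneg_of_le (fun n => by positivity) (fun n => ?_)
      (Real.summable_pow_div_factorial (‖w‖ * |R|))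
    rw [mul_pow]
    calc ‖dunklCoeff k w n‖ * |R| ^ n ≤ ‖w‖ ^ n / n.factorial * |R| ^ n := by
          gcongr; exact dunklCoeff_norm_le hk w n
      _ = _ := by ring
  have hbound : ∀ R : ℝ, ∀ (n : ℕ) (z : ℂ), z ∈ Metric.ball (0 : ℂ) R →
      ‖dunklCoeff k w n * z ^ n‖ ≤ ‖dunklCoeff k w n‖ * |R| ^ n := by
    intro R n z hz
    rw [norm_mul, norm_pow]
    have : ‖z‖ ≤ |R| := (mem_ball_zero_iff.mp hz).le.trans (le_abs_self R)
    gcongr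
  have hdiff : ∀ R : ℝ, ∀ n : ℕ,
      DifferentiableOn ℂ (fun z : ℂ => dunklCoeff k w n * z ^ n) (Metric.ball 0 R) := by
    intro R n; fun_prop
  have hser : ∀ z : ℂ, HasSum (fun n : ℕ => dunklCoeff k w n * z ^ n)
      (∑' n : ℕ, dunklCoeff k w n * z ^ n) := by
    intro z
    refine (Summable.of_norm_bounded (hsumm (‖z‖ + 1)) fun n => ?_).hasSum
    exact hbound _ n z (by simp)
  refine ⟨fun z => ?_, fun z hz => ?_, ?_⟩
  · have hz : z ∈ Metric.ball (0 : ℂ) (‖z‖ + 1) := by simp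
    exact (Complex.differentiableOn_tsum_of_summable_norm (hsumm (‖z‖ + 1)) (hdiff _)
      Metric.isOpen_ball (hbound _)).differentiableAt (Metric.isOpen_ball.mem_nhds hz)
  · have hzb : z ∈ Metric.ball (0 : ℂ) (‖z‖ + 1) := by simp
    have h1 := Complex.hasSum_deriv_of_summable_norm (hsumm (‖z‖ + 1)) (hdiff _)
      Metric.isOpen_ball (hbound _) hzb
    have h2 := (((hser z).sub (hser (-z))).div_const z).mul_left (k : ℂ)
    have h3 := h1.add h2
    have h4 := (hser z).mul_left w
    unfold dunklOperator
    rw [← hasSum_nat_add_iff' 1] at h3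
    simp only [Finset.range_one, Finset.sum_singleton, pow_zero, mul_one, sub_self, zero_div,
      mul_zero, add_zero, deriv_const', sub_zero] at h3
    refine h3.unique ?_
    refine (congrArg (fun g : ℕ → ℂ => HasSum g _) (funext fun n => ?_)).mpr h4
    have hden : (((n + 1 : ℕ) : ℂ) + k * (1 - (-1) ^ (n + 1))) ≠ 0 := by
      have hp : (0 : ℝ) ≤ 1 - (-1) ^ (n + 1) := by
        rcases neg_one_pow_eq_or ℝ (n + 1) with h | h <;> rw [h] <;> norm_num
      have hpos : (0 : ℝ) < ((n + 1 : ℕ) : ℝ) := by positivity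
      have : (((n + 1 : ℕ) : ℝ) + k * (1 - (-1) ^ (n + 1))) ≠ 0 := by
        nlinarith [mul_nonneg hk hp]
      exact_mod_cast this
    have hc : dunklCoeff k w (n + 1) * (((n + 1 : ℕ) : ℂ) + k * (1 - (-1) ^ (n + 1)))
        = w * dunklCoeff k w n := by
      rw [dunklCoeff]; field_simp
    have hdv : deriv (fun z : ℂ => dunklCoeff k w (n + 1) * z ^ (n + 1)) z
        = dunklCoeff k w (n + 1) * (((n + 1 : ℕ) : ℂ) * z ^ n) := by
      simp
    rw [hdv, neg_pow z]
    have : (k : ℂ) * ((dunklCoeff k w (n + 1) * z ^ (n + 1)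
        - dunklCoeff k w (n + 1) * ((-1) ^ (n + 1) * z ^ (n + 1))) / z)
        = dunklCoeff k w (n + 1) * (k * (1 - (-1) ^ (n + 1))) * z ^ n := by
      field_simp; ring
    rw [this]
    linear_combination z ^ n * hc
  · rw [tsum_eq_single 0 (by intro n hn; simp [hn])]
    simp [dunklCoeff]

/-- The Dunkl kernel `E_k(z, w)`: the function `z ↦ E_k(z, w)` is the holomorphic solution `f` of
`T(k) f = w f`, `f 0 = 1`. -/
def dunklKernel (k : ℝ) (z w : ℂ) : ℂ :=
  Classical.epsilon (IsDunklEigenfunction k w) z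

/-- For `k ≥ 0` the Dunkl kernel does solve the eigenvalue problem. -/
theorem isDunklEigenfunction_dunklKernel {k : ℝ} (hk : 0 ≤ k) (w : ℂ) :
    IsDunklEigenfunction k w (fun z => dunklKernel k z w) :=
  Classical.epsilon_spec ⟨_, isDunklEigenfunction_tsum hk w⟩

/-- The Dunkl kernel on `ℝ × ℝ`, where its values are real. -/
def dunklKernelReal (k x y : ℝ) : ℝ := (dunklKernel k (x : ℂ) (y : ℂ)).re

/-- The normalization constant `c_k = 1 / (2^(k + 1/2) Γ(k + 1/2))`. -/
def dunklConst (k : ℝ) : ℝ := 1 / ((2 : ℝ) ^ (k + 1 / 2) * Real.Gamma (k + 1 / 2))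

/-- The Lebesgue density `y ↦ p_t(x, y)`, `t > 0`, of the transition kernel of the one-dimensional
Dunkl process with multiplicity `k` and drift `lam`; the weight is `w_k(y) = |y|^(2k)`. -/
def dunklTransitionDensity (k lam t x y : ℝ) : ℝ :=
  dunklConst k * Real.exp (-(lam ^ 2 * t / 2)) / t ^ (k + 1 / 2)
    * Real.exp (-(x ^ 2 + y ^ 2) / (2 * t))
    * (dunklKernelReal k (x / √t) (y / √t) * dunklKernelReal k y lam / dunklKernelReal k x lam)
    * |y| ^ (2 * k)

/-- The transition kernel `K_t(x, ·)`, `t > 0`. -/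
def dunklTransition (k lam t x : ℝ) : Measure ℝ :=
  volume.withDensity fun y => ENNReal.ofReal (dunklTransitionDensity k lam t x y)

/-- `X` is a one-dimensional Dunkl process with multiplicity `k`, drift `lam` and start in `x₀`:
a Markov process (with respect to its own filtration) with transition kernels `K_t`. -/
structure IsDunklProcess {Ω : Type*} [MeasurableSpace Ω] (P : Measure Ω) (k lam x₀ : ℝ)
    (X : ℝ≥0 → Ω → ℝ) : Prop where
  measurable : ∀ t, Measurable (X t)
  start : ∀ᵐ ω ∂P, X 0 ω = x₀
  markov : ∀ s t : ℝ≥0, s < t → ∀ A : Set ℝ, MeasurableSet A →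
    P[(X t ⁻¹' A).indicator (fun _ => (1 : ℝ)) |
        Filtration.natural X (fun u => (measurable u).stronglyMeasurable) s]
      =ᵐ[P] fun ω => (dunklTransition k lam ((t : ℝ) - (s : ℝ)) (X s ω) A).toReal

/-- The explicit density `φ_t` of `(X_t - t lam) / √t` for the process started in `0`. -/
def dunklNormalizedDensity (k lam t y : ℝ) : ℝ :=
  dunklConst k * Real.exp (-(lam ^ 2 * t / 2)) / t ^ k
    * Real.exp (-(y * √t + lam * t) ^ 2 / (2 * t))
    * dunklKernelReal k (y * √t + lam * t) lam
    * |y * √t + lam * t| ^ (2 * k)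

end

/-!
The Dunkl kernel is `E_k(x, y) = e ^ (x y) ₁F₁(k; 2k + 1; -2 x y)`. The factor `₁F₁(k; 2k + 1; ·)`
is the moment generating function of the beta distribution `B(k, k + 1)`: Kummer's transformation is
the reflection `v ↦ 1 - v` of the beta distributions, and his contiguous relation, which becomes the
Dunkl eigenvalue equation, is Stein's identity applied to exponentials. Watson's lemma for this
moment generating function gives `c_k (x y) ^ k e ^ (-x y) E_k(x, y) → 1 / √(2π)` as `x y → ∞`.

With `x = y √t + λ t`, completing the square writes `φ_t(y)` as `e ^ (-y² / 2)` times this quantity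
at `(x, λ)` times `(x / (λ t)) ^ k`. Here `x λ → ∞` and `x / (λ t) → 1`, jointly in `t → ∞` and `y`
near a given point, hence the locally uniform limit. Convergence in distribution follows from
convergence of the densities by Fatou's lemma on open sets.
-/

section BetaDistribution

variable {α β : ℝ}

theorem betaPDFReal_of_mem_Ioo {v : ℝ} (hv : v ∈ Set.Ioo (0 : ℝ) 1) :
    betaPDFReal α β v = 1 / beta α β * v ^ (α - 1) * (1 - v) ^ (β - 1) := if_pos hv

theorem betaPDFReal_of_notMem_Ioo {v : ℝ} (hv : v ∉ Set.Ioo (0 : ℝ) 1) :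
    betaPDFReal α β v = 0 := if_neg hv

theorem betaPDFReal_nonneg (hα : 0 < α) (hβ : 0 < β) (v : ℝ) : 0 ≤ betaPDFReal α β v := by
  by_cases hv : v ∈ Set.Ioo (0 : ℝ) 1
  · exact (betaPDFReal_pos hv.1 hv.2 hα hβ).le
  · exact (betaPDFReal_of_notMem_Ioo hv).ge

theorem betaPDFReal_one_sub (v : ℝ) : betaPDFReal α β (1 - v) = betaPDFReal β α v := by
  simp only [betaPDFReal, beta, sub_pos, sub_lt_self_iff, sub_sub_cancel, and_comm (a := v < 1),
    mul_comm (Real.Gamma α), add_comm α, mul_right_comm _ ((1 - v) ^ (α - 1))]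

theorem measurable_betaPDF : Measurable (betaPDF α β) :=
  (measurable_betaPDFReal α β).ennreal_ofReal

theorem integrable_betaPDFReal (hα : 0 < α) (hβ : 0 < β) : Integrable (betaPDFReal α β) := by
  refine ⟨(measurable_betaPDFReal α β).aestronglyMeasurable, ?_⟩
  rw [hasFiniteIntegral_iff_ofReal (ae_of_all _ (betaPDFReal_nonneg hα hβ))]
  exact (lintegral_betaPDF_eq_one hα hβ).trans_lt ENNReal.one_lt_top

theorem mul_beta_add_one_right (hα : 0 < α) (hβ : 0 < β) :
    α * beta α (β + 1) = β * beta (α + 1) β := by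
  rw [beta, beta, Real.Gamma_add_one hα.ne', Real.Gamma_add_one hβ.ne', add_right_comm α 1 β,
    ← add_assoc]
  ring

theorem hasDerivAt_rpow_mul_one_sub_rpow_div_beta (hα : 0 < α) (hβ : 0 < β) {v : ℝ}
    (hv : v ∈ Set.Ioo (0 : ℝ) 1) :
    HasDerivAt (fun v => v ^ α * (1 - v) ^ β / (α * beta α (β + 1)))
      (betaPDFReal α (β + 1) v - betaPDFReal (α + 1) β v) v := by
  have h1v : 0 < 1 - v := sub_pos.mpr hv.2
  have hB : 0 < beta α (β + 1) := beta_pos hα (by positivity)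
  have hB' : beta (α + 1) β = α * beta α (β + 1) / β := by
    rw [mul_beta_add_one_right hα hβ, mul_div_cancel_left₀ _ hβ.ne']
  have hleft := Real.hasDerivAt_rpow_const (p := α) (Or.inl hv.1.ne')
  have hright := ((hasDerivAt_id v).const_sub 1).rpow_const (p := β) (Or.inl h1v.ne')
  convert! (hleft.mul hright).div_const (α * beta α (β + 1)) using 1
  rw [betaPDFReal_of_mem_Ioo hv, betaPDFReal_of_mem_Ioo hv, hB', add_sub_cancel_right,
    add_sub_cancel_right]
  simp only [id]
  field_simp
  ring

variable {E : Type*} [NormedAddCommGroup E] [NormedSpace ℝ E]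

theorem integral_betaMeasure (hα : 0 < α) (hβ : 0 < β) (g : ℝ → E) :
    ∫ v, g v ∂betaMeasure α β = ∫ v, betaPDFReal α β v • g v := by
  rw [betaMeasure, integral_withDensity_eq_integral_toReal_smul
    measurable_betaPDF (ae_of_all _ fun v => ENNReal.ofReal_lt_top)]
  simp only [betaPDF, ENNReal.toReal_ofReal (betaPDFReal_nonneg hα hβ _)]

theorem intervalIntegral_betaPDFReal_smul (hα : 0 < α) (hβ : 0 < β) (g : ℝ → E) :
    ∫ v in (0 : ℝ)..1, betaPDFReal α β v • g v = ∫ v, g v ∂betaMeasure α β := by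
  rw [integral_betaMeasure hα hβ, intervalIntegral.integral_of_le zero_le_one,
    integral_Ioc_eq_integral_Ioo]
  refine setIntegral_eq_integral_of_forall_compl_eq_zero fun v hv => ?_
  rw [betaPDFReal_of_notMem_Ioo hv, zero_smul]

theorem integral_betaMeasure_comp_one_sub (hα : 0 < α) (hβ : 0 < β) (g : ℝ → E) :
    ∫ v, g (1 - v) ∂betaMeasure α β = ∫ v, g v ∂betaMeasure β α := by
  rw [integral_betaMeasure hα hβ, integral_betaMeasure hβ hα, ← integral_sub_left_eq_self _ _ 1]
  simp only [betaPDFReal_one_sub, sub_sub_cancel]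

theorem ae_mem_Icc_betaMeasure : ∀ᵐ v ∂betaMeasure α β, v ∈ Set.Icc (0 : ℝ) 1 := by
  rw [betaMeasure, ae_withDensity_iff measurable_betaPDF]
  refine ae_of_all _ fun v hv => Set.Ioo_subset_Icc_self ?_
  by_contra hv'
  exact hv (by rw [betaPDF, betaPDFReal_of_notMem_Ioo hv', ENNReal.ofReal_zero])

/-- Stein's identity for the beta distributions. -/
theorem smul_integral_betaMeasure_add_one_left_sub [CompleteSpace E] (hα : 0 < α) (hβ : 0 < β)
    {g g' : ℝ → E} (hg : ContinuousOn g (Set.Icc 0 1))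
    (hgg' : ∀ v ∈ Set.Ioo (0 : ℝ) 1, HasDerivAt g (g' v) v)
    (hg' : IntervalIntegrable g' volume 0 1) :
    α • (∫ v, g v ∂betaMeasure (α + 1) β - ∫ v, g v ∂betaMeasure α (β + 1))
      = ∫ v, v • g' v ∂betaMeasure α (β + 1) := by
  have hα1 : 0 < α + 1 := by positivity
  have hβ1 : 0 < β + 1 := by positivity
  have hB : 0 < beta α (β + 1) := beta_pos hα hβ1
  have hG : ContinuousOn (fun v : ℝ => v ^ α * (1 - v) ^ β / (α * beta α (β + 1)))
      (Set.uIcc 0 1) :=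
    (((Real.continuous_rpow_const hα.le).mul ((Real.continuous_rpow_const hβ.le).comp
      (continuous_const.sub continuous_id))).div_const _).continuousOn
  have hgu : ContinuousOn g (Set.uIcc 0 1) := by rwa [Set.uIcc_of_le zero_le_one]
  have hi := (integrable_betaPDFReal hα hβ1).intervalIntegrable (a := 0) (b := 1)
  have hi' := (integrable_betaPDFReal hα1 hβ).intervalIntegrable (a := 0) (b := 1)
  have hparts := intervalIntegral.integral_smul_deriv_eq_deriv_smul_of_hasDerivAt hG hgu
    (by simpa using fun v h0 h1 => hasDerivAt_rpow_mul_one_sub_rpow_div_beta hα hβ ⟨h0, h1⟩)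
    (by simpa using hgg') (hi.sub hi') hg'
  have hGpdf : ∫ v in (0 : ℝ)..1, (v ^ α * (1 - v) ^ β / (α * beta α (β + 1))) • g' v
      = α⁻¹ • ∫ v, v • g' v ∂betaMeasure α (β + 1) := by
    rw [← intervalIntegral_betaPDFReal_smul hα hβ1, ← intervalIntegral.integral_smul]
    refine intervalIntegral.integral_congr_Ioo_of_le zero_le_one fun v hv => ?_
    have hvα : v ^ α = v * v ^ (α - 1) := by
      rw [Real.rpow_sub_one hv.1.ne', mul_div_cancel₀ _ hv.1.ne']
    simp only [smul_smul]
    congr 1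
    rw [betaPDFReal_of_mem_Ioo hv, add_sub_cancel_right, hvα]
    field_simp
  simp only [sub_smul, Real.zero_rpow hα.ne', sub_self, Real.zero_rpow hβ.ne', mul_zero, zero_mul,
    zero_div, zero_smul, zero_sub] at hparts
  rw [intervalIntegral.integral_sub (hi.smul_continuousOn hgu) (hi'.smul_continuousOn hgu),
    intervalIntegral_betaPDFReal_smul hα hβ1, intervalIntegral_betaPDFReal_smul hα1 hβ,
    neg_sub, hGpdf] at hparts
  rw [← hparts, smul_inv_smul₀ hα.ne']

theorem integrableExpSet_id_betaMeasure (hα : 0 < α) (hβ : 0 < β) :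
    integrableExpSet id (betaMeasure α β) = Set.univ := by
  have := isProbabilityMeasureBeta hα hβ
  exact Set.eq_univ_of_forall fun _ => integrable_exp_mul_of_mem_Icc aemeasurable_id
    ae_mem_Icc_betaMeasure

theorem hasDerivAt_complexMGF_betaMeasure (hα : 0 < α) (hβ : 0 < β) (s : ℂ) :
    HasDerivAt (complexMGF id (betaMeasure α β))
      (∫ v, (v : ℂ) * Complex.exp (s * v) ∂betaMeasure α β) s :=
  hasDerivAt_complexMGF (by simp [integrableExpSet_id_betaMeasure hα hβ])

/-- Kummer's transformation: `complexMGF id (betaMeasure α β)` is the confluent hypergeometric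
function `₁F₁(α; α + β; ·)`. -/
theorem complexMGF_betaMeasure_swap (hα : 0 < α) (hβ : 0 < β) (s : ℂ) :
    complexMGF id (betaMeasure β α) s
      = Complex.exp s * complexMGF id (betaMeasure α β) (-s) := by
  rw [complexMGF, complexMGF, ← integral_betaMeasure_comp_one_sub hα hβ, ← integral_const_mul]
  congr 1 with v
  rw [← Complex.exp_add]
  congr 1
  push_cast [id]
  ring

/-- A contiguous relation for the confluent hypergeometric functions `₁F₁(·; α + β + 1; s)`. -/
theorem mul_complexMGF_betaMeasure_add_one_left_sub (hα : 0 < α) (hβ : 0 < β) (s : ℂ) :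
    α * (complexMGF id (betaMeasure (α + 1) β) s - complexMGF id (betaMeasure α (β + 1)) s)
      = s * deriv (complexMGF id (betaMeasure α (β + 1))) s := by
  have hexp (v : ℝ) : HasDerivAt (fun v : ℝ => Complex.exp (s * v)) (Complex.exp (s * v) * s) v :=
    (((hasDerivAt_id (v : ℂ)).const_mul s).cexp.comp_ofReal).congr_deriv (by simp)
  have hstein := smul_integral_betaMeasure_add_one_left_sub hα hβ
    (Continuous.continuousOn (by fun_prop)) (fun v _ => hexp v)
    (Continuous.intervalIntegrable (by fun_prop) 0 1)
  rw [Complex.real_smul] at hstein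
  rw [(hasDerivAt_complexMGF_betaMeasure hα (by positivity) s).deriv, ← integral_const_mul]
  refine hstein.trans (integral_congr_ae (ae_of_all _ fun v => ?_))
  simp only [Complex.real_smul]
  ring

end BetaDistribution

section LaplaceAsymptotics

variable {α : ℝ} {E : Type*} [NormedAddCommGroup E] [NormedSpace ℝ E]

theorem rpow_smul_integral_rpow_mul_exp_neg_smul (g : ℝ → E) {a : ℝ} (ha : 0 < a) :
    a ^ α • ∫ v in Set.Ioi (0 : ℝ), (v ^ (α - 1) * Real.exp (-(a * v))) • g v
      = ∫ s in Set.Ioi (0 : ℝ), (Real.exp (-s) * s ^ (α - 1)) • g (a⁻¹ * s) := by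
  have hsubst := integral_comp_mul_left_Ioi'
    (fun s => (Real.exp (-s) * s ^ (α - 1)) • g (a⁻¹ * s)) 0 ha
  have haα : a ^ α = a * a ^ (α - 1) := by
    rw [Real.rpow_sub_one ha.ne', mul_div_cancel₀ _ ha.ne']
  rw [mul_zero] at hsubst
  rw [← hsubst, haα, mul_smul, ← integral_smul]
  congr 1
  refine setIntegral_congr_fun measurableSet_Ioi fun v (hv : 0 < v) => ?_
  simp only [smul_smul, inv_mul_cancel_left₀ ha.ne', Real.mul_rpow ha.le hv.le]
  congr 1
  ring

/-- Watson's lemma. -/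
theorem tendsto_rpow_smul_integral_rpow_mul_exp_neg_smul [CompleteSpace E] (hα : 0 < α)
    {g : ℝ → E} {C : ℝ} {L : E} (hg : StronglyMeasurable g) (hC : ∀ v, 0 < v → ‖g v‖ ≤ C)
    (hL : Tendsto g (𝓝[>] 0) (𝓝 L)) :
    Tendsto (fun a : ℝ =>
        a ^ α • ∫ v in Set.Ioi (0 : ℝ), (v ^ (α - 1) * Real.exp (-(a * v))) • g v)
      atTop (𝓝 (Real.Gamma α • L)) := by
  rw [Real.Gamma_eq_integral hα, ← integral_smul_const]
  suffices Tendsto (fun a : ℝ =>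
      ∫ s in Set.Ioi (0 : ℝ), (Real.exp (-s) * s ^ (α - 1)) • g (a⁻¹ * s)) atTop
      (𝓝 (∫ s in Set.Ioi (0 : ℝ), (Real.exp (-s) * s ^ (α - 1)) • L)) from
    this.congr' ((eventually_gt_atTop 0).mono fun a ha =>
      (rpow_smul_integral_rpow_mul_exp_neg_smul g ha).symm)
  refine tendsto_integral_filter_of_dominated_convergence
    (fun s => Real.exp (-s) * s ^ (α - 1) * C) ?_ ?_
    ((Real.GammaIntegral_convergent hα).mul_const C) ?_
  · exact Eventually.of_forall fun a => (StronglyMeasurable.smul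
      (Measurable.stronglyMeasurable (by fun_prop))
      (hg.comp_measurable (by fun_prop))).aestronglyMeasurable
  · filter_upwards [eventually_gt_atTop 0] with a ha
    filter_upwards [ae_restrict_mem measurableSet_Ioi] with s (hs : 0 < s)
    rw [norm_smul, Real.norm_of_nonneg (by positivity)]
    gcongr
    exact hC _ (by positivity)
  · filter_upwards [ae_restrict_mem measurableSet_Ioi] with s (hs : 0 < s)
    have hto : Tendsto (fun a : ℝ => a⁻¹ * s) atTop (𝓝[>] 0) := by
      refine tendsto_nhdsWithin_iff.mpr ⟨?_, ?_⟩
      · simpa using tendsto_inv_atTop_zero.mul_const s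
      · filter_upwards [eventually_gt_atTop 0] with a ha
        exact mul_pos (inv_pos.mpr ha) hs
    exact (hL.comp hto).const_smul _

theorem mgf_betaMeasure {β : ℝ} (hα : 0 < α) (hβ : 0 < β) (s : ℝ) :
    mgf id (betaMeasure α β) s = ∫ v in Set.Ioi (0 : ℝ), (v ^ (α - 1) * Real.exp (s * v)) •
      (Set.Iio 1).indicator (fun v => (1 - v) ^ (β - 1) / beta α β) v := by
  rw [mgf, integral_betaMeasure hα hβ]
  rw [← setIntegral_eq_integral_of_forall_compl_eq_zero (s := Set.Ioi 0) fun v hv => by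
    rw [betaPDFReal_of_notMem_Ioo fun h => hv h.1, zero_smul]]
  refine setIntegral_congr_fun measurableSet_Ioi fun v (hv : 0 < v) => ?_
  by_cases hv1 : v ∈ Set.Iio 1
  · simp only [betaPDFReal_of_mem_Ioo ⟨hv, hv1⟩, Set.indicator_of_mem hv1, id, smul_eq_mul]
    ring
  · simp only [betaPDFReal_of_notMem_Ioo fun h => hv1 h.2, Set.indicator_of_notMem hv1, smul_zero,
      zero_smul]

theorem tendsto_rpow_mul_mgf_betaMeasure_neg {β : ℝ} (hα : 0 < α) (hβ : 1 ≤ β) :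
    Tendsto (fun a : ℝ => a ^ α * mgf id (betaMeasure α β) (-a)) atTop
      (𝓝 (Real.Gamma (α + β) / Real.Gamma β)) := by
  have hβ0 : 0 < β := one_pos.trans_le hβ
  have hB := beta_pos hα hβ0
  let g : ℝ → ℝ := (Set.Iio 1).indicator fun v => (1 - v) ^ (β - 1) / beta α β
  have hg : StronglyMeasurable g :=
    (Measurable.indicator (by fun_prop) measurableSet_Iio).stronglyMeasurable
  have hbound (v : ℝ) (hv : 0 < v) : ‖g v‖ ≤ 1 / beta α β := by
    rw [norm_indicator_eq_indicator_norm]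
    refine Set.indicator_apply_le' (fun hv1 => ?_) fun _ => by positivity
    have h1v : 0 < 1 - v := sub_pos.mpr hv1
    rw [Real.norm_of_nonneg (by positivity)]
    gcongr
    exact Real.rpow_le_one h1v.le (sub_le_self 1 hv.le) (sub_nonneg.mpr hβ)
  have hlim : Tendsto g (𝓝[>] 0) (𝓝 (1 / beta α β)) := by
    have hcont : ContinuousAt (fun v : ℝ => (1 - v) ^ (β - 1) / beta α β) 0 := by
      fun_prop (disch := simp)
    have hcont0 := hcont.tendsto
    rw [sub_zero, Real.one_rpow] at hcont0
    refine (hcont0.congr' ?_).mono_left nhdsWithin_le_nhds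
    exact (Set.eqOn_indicator.symm).eventuallyEq_of_mem (Iio_mem_nhds one_pos)
  have hGamma : Real.Gamma α * (1 / beta α β) = Real.Gamma (α + β) / Real.Gamma β := by
    have := Real.Gamma_pos_of_pos hα
    rw [beta]
    field_simp
  rw [← hGamma]
  simp only [mgf_betaMeasure hα hβ0, neg_mul]
  exact tendsto_rpow_smul_integral_rpow_mul_exp_neg_smul hα hg hbound hlim

end LaplaceAsymptotics

section DunklKernel

variable {k : ℝ}

theorem isDunklEigenfunction_exp_mul_complexMGF (hk : 0 < k) (w : ℂ) :
    IsDunklEigenfunction k w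
      (fun z => Complex.exp (w * z) * complexMGF id (betaMeasure k (k + 1)) (-2 * w * z)) := by
  have hk1 : 0 < k + 1 := by positivity
  have := isProbabilityMeasureBeta hk hk1
  set M := complexMGF id (betaMeasure k (k + 1)) with hM
  have hMdiff (s : ℂ) : HasDerivAt M (deriv M s) s :=
    (hasDerivAt_complexMGF_betaMeasure hk hk1 s).differentiableAt.hasDerivAt
  have hderiv (z : ℂ) : HasDerivAt (fun z => Complex.exp (w * z) * M (-2 * w * z))
      (w * (Complex.exp (w * z) * M (-2 * w * z))
        - 2 * w * (Complex.exp (w * z) * deriv M (-2 * w * z))) z := by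
    have hexp := ((hasDerivAt_id z).const_mul w).cexp
    have hMz := (hMdiff (-2 * w * z)).comp z ((hasDerivAt_id z).const_mul (-2 * w))
    refine (hexp.mul hMz).congr_deriv ?_
    simp only [id, Function.comp_apply]
    ring
  refine ⟨fun z => (hderiv z).differentiableAt, fun z hz => ?_, by simp [hM, complexMGF]⟩
  have hreflect : Complex.exp (w * -z) * M (-2 * w * -z)
      = Complex.exp (w * z) * complexMGF id (betaMeasure (k + 1) k) (-2 * w * z) := by
    rw [complexMGF_betaMeasure_swap hk hk1, ← mul_assoc, ← Complex.exp_add]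
    congr 2 <;> ring
  have hkummer := mul_complexMGF_betaMeasure_add_one_left_sub hk hk (-2 * w * z)
  rw [← hM] at hkummer
  rw [dunklOperator, (hderiv z).deriv, hreflect]
  calc
    _ = w * (Complex.exp (w * z) * M (-2 * w * z))
        - Complex.exp (w * z) * (2 * w * deriv M (-2 * w * z)
          + k * (complexMGF id (betaMeasure (k + 1) k) (-2 * w * z) - M (-2 * w * z)) / z) := by
      ring
    _ = w * (Complex.exp (w * z) * M (-2 * w * z)) := by
      rw [hkummer, mul_div_right_comm, mul_div_cancel_right₀ _ hz]
      ring

theorem dunklKernelReal_eq_exp_mul_mgf (hk : 0 < k) (x y : ℝ) :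
    dunklKernelReal k x y
      = Real.exp (x * y) * mgf id (betaMeasure k (k + 1)) (-(2 * (x * y))) := by
  have hunique := (isDunklEigenfunction_dunklKernel hk.le (y : ℂ)).unique hk.le
    (isDunklEigenfunction_exp_mul_complexMGF hk y)
  have harg : -2 * (y : ℂ) * x = ((-(2 * (x * y)) : ℝ) : ℂ) := by push_cast; ring
  rw [dunklKernelReal, congrFun hunique x, harg, complexMGF_ofReal, mul_comm (y : ℂ)]
  norm_cast

theorem Gamma_two_mul_add_one_div_Gamma_add_one (hk : -1 < k) :
    Real.Gamma (2 * k + 1) / Real.Gamma (k + 1)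
      = 2 ^ (2 * k) * Real.Gamma (k + 1 / 2) / √Real.pi := by
  have hdup := Real.Gamma_mul_Gamma_add_half (k + 1 / 2)
  have hG : 0 < Real.Gamma (k + 1) := Real.Gamma_pos_of_pos (by linarith)
  rw [show k + 1 / 2 + 1 / 2 = k + 1 by ring, show 2 * (k + 1 / 2) = 2 * k + 1 by ring,
    show 1 - (2 * k + 1) = -(2 * k) by ring, Real.rpow_neg zero_le_two] at hdup
  field_simp at hdup ⊢
  linear_combination -hdup

theorem tendsto_rpow_mul_exp_neg_mul_dunklKernelReal (hk : 0 < k) :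
    Tendsto (fun p : ℝ × ℝ => dunklConst k *
        ((p.1 * p.2) ^ k * Real.exp (-(p.1 * p.2)) * dunklKernelReal k p.1 p.2))
      (comap (fun p => p.1 * p.2) atTop) (𝓝 (√(2 * Real.pi))⁻¹) := by
  have hk1 : (1 : ℝ) ≤ k + 1 := le_add_of_nonneg_left hk.le
  have hconst : dunklConst k / 2 ^ k * (Real.Gamma (k + (k + 1)) / Real.Gamma (k + 1))
      = (√(2 * Real.pi))⁻¹ := by
    have : 0 < Real.Gamma (k + 1 / 2) := Real.Gamma_pos_of_pos (by positivity)
    rw [← add_assoc, ← two_mul, Gamma_two_mul_add_one_div_Gamma_add_one (by linarith), dunklConst,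
      Real.rpow_add two_pos, ← Real.sqrt_eq_rpow, two_mul, Real.rpow_add two_pos,
      Real.sqrt_mul zero_le_two]
    field_simp
  have hwatson : Tendsto (fun p : ℝ × ℝ => (2 * (p.1 * p.2)) ^ k *
      mgf id (betaMeasure k (k + 1)) (-(2 * (p.1 * p.2)))) (comap (fun p => p.1 * p.2) atTop)
      (𝓝 (Real.Gamma (k + (k + 1)) / Real.Gamma (k + 1))) :=
    (tendsto_rpow_mul_mgf_betaMeasure_neg hk hk1).comp
      (tendsto_comap.const_mul_atTop two_pos)
  rw [← hconst]
  refine (hwatson.const_mul (dunklConst k / 2 ^ k)).congr' ?_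
  filter_upwards [tendsto_comap.eventually_ge_atTop 0] with p hp
  rw [dunklKernelReal_eq_exp_mul_mgf hk, Real.mul_rpow zero_le_two hp, Real.exp_neg]
  field_simp

end DunklKernel

section NormalizedDensity

variable {k lam : ℝ}

theorem dunklNormalizedDensity_eq_exp_mul {t y x : ℝ} (hx : x = y * √t + lam * t) (ht : 0 < t)
    (hxlam : 0 < x * lam) :
    dunklNormalizedDensity k lam t y = Real.exp (-y ^ 2 / 2)
      * (dunklConst k * ((x * lam) ^ k * Real.exp (-(x * lam)) * dunklKernelReal k x lam))
      * (x / (lam * t)) ^ k := by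
  have hlam : lam ≠ 0 := right_ne_zero_of_mul hxlam.ne'
  have hratio : 0 < x / (lam * t) := by
    rw [← mul_div_mul_right x (lam * t) hlam, mul_right_comm, ← sq]
    exact div_pos hxlam (by positivity)
  have hexp : Real.exp (-(lam ^ 2 * t / 2)) * Real.exp (-x ^ 2 / (2 * t))
      = Real.exp (-y ^ 2 / 2) * Real.exp (-(x * lam)) := by
    rw [← Real.exp_add, ← Real.exp_add, hx]
    congr 1
    field_simp
    linear_combination -y ^ 2 * Real.sq_sqrt ht.le
  have hpow : |x| ^ (2 * k) / t ^ k = (x * lam) ^ k * (x / (lam * t)) ^ k := by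
    rw [Real.rpow_mul (abs_nonneg x), Real.rpow_two, sq_abs, ← Real.div_rpow (sq_nonneg x) ht.le,
      ← Real.mul_rpow hxlam.le hratio.le]
    congr 1
    field_simp
  rw [dunklNormalizedDensity, ← hx]
  calc
    _ = dunklConst k * (Real.exp (-(lam ^ 2 * t / 2)) * Real.exp (-x ^ 2 / (2 * t)))
        * dunklKernelReal k x lam * (|x| ^ (2 * k) / t ^ k) := by ring
    _ = _ := by rw [hexp, hpow]; ring

theorem tendsto_add_div_mul_self (hlam : lam ≠ 0) (y₀ : ℝ) :
    Tendsto (fun q : ℝ × ℝ => (q.2 * √q.1 + lam * q.1) / (lam * q.1)) (atTop ×ˢ 𝓝 y₀) (𝓝 1) := by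
  have hsqrt : Tendsto (fun q : ℝ × ℝ => √q.1) (atTop ×ˢ 𝓝 y₀) atTop :=
    Real.tendsto_sqrt_atTop.comp tendsto_fst
  have hlim := ((tendsto_snd.div_atTop hsqrt).div_const lam).add_const 1
  rw [zero_div, zero_add] at hlim
  refine hlim.congr' ?_
  filter_upwards [tendsto_fst.eventually_gt_atTop 0] with q hq
  have hq' : √q.1 ≠ 0 := (Real.sqrt_pos.mpr hq).ne'
  field_simp
  linear_combination -q.2 * Real.sq_sqrt hq.le

theorem tendsto_mul_sqrt_add_mul_mul (hlam : lam ≠ 0) (y₀ : ℝ) :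
    Tendsto (fun q : ℝ × ℝ => (q.2 * √q.1 + lam * q.1) * lam) (atTop ×ˢ 𝓝 y₀) atTop := by
  have hlam2 : 0 < lam ^ 2 := by positivity
  have hlim := (tendsto_fst.const_mul_atTop hlam2).atTop_mul_pos one_pos
    (tendsto_add_div_mul_self hlam y₀)
  refine hlim.congr' ?_
  filter_upwards [tendsto_fst.eventually_gt_atTop 0] with q hq
  field_simp

theorem tendsto_dunklNormalizedDensity (hk : 0 < k) (hlam : lam ≠ 0) (y₀ : ℝ) :
    Tendsto (fun q : ℝ × ℝ => dunklNormalizedDensity k lam q.1 q.2) (atTop ×ˢ 𝓝 y₀)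
      (𝓝 (gaussianPDFReal 0 1 y₀)) := by
  have hxlam := tendsto_mul_sqrt_add_mul_mul hlam y₀
  have hkernel := (tendsto_rpow_mul_exp_neg_mul_dunklKernelReal hk).comp
    (tendsto_comap_iff (f := fun q : ℝ × ℝ => (q.2 * √q.1 + lam * q.1, lam)).mpr hxlam)
  have hratio := (tendsto_add_div_mul_self hlam y₀).rpow_const (p := k) (Or.inr hk.le)
  have hgauss : Tendsto (fun q : ℝ × ℝ => Real.exp (-q.2 ^ 2 / 2)) (atTop ×ˢ 𝓝 y₀)
      (𝓝 (Real.exp (-y₀ ^ 2 / 2))) :=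
    ((show Continuous fun y : ℝ => Real.exp (-y ^ 2 / 2) by fun_prop).tendsto y₀).comp tendsto_snd
  have hlim := (hgauss.mul hkernel).mul hratio
  have hpdf : gaussianPDFReal 0 1 y₀ = Real.exp (-y₀ ^ 2 / 2) * (√(2 * Real.pi))⁻¹ * 1 ^ k := by
    simp [gaussianPDFReal, mul_comm]
  rw [hpdf]
  refine hlim.congr' ?_
  filter_upwards [tendsto_fst.eventually_gt_atTop 0, hxlam.eventually_gt_atTop 0] with q hq hqlam
  exact (dunklNormalizedDensity_eq_exp_mul rfl hq hqlam).symm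

theorem tendstoLocallyUniformly_dunklNormalizedDensity (hk : 0 < k) (hlam : lam ≠ 0) :
    TendstoLocallyUniformly (fun t y : ℝ => dunklNormalizedDensity k lam t y)
      (gaussianPDFReal 0 1) atTop := by
  rw [tendstoLocallyUniformly_iff_forall_tendsto]
  intro y₀
  have hgauss : Continuous (gaussianPDFReal 0 1) := by unfold gaussianPDFReal; fun_prop
  exact (((hgauss.tendsto y₀).comp tendsto_snd).prodMk_nhds
    (tendsto_dunklNormalizedDensity hk hlam y₀)).mono_right (nhds_le_uniformity _)

theorem measurable_dunklNormalizedDensity (hk : 0 ≤ k) (t : ℝ) :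
    Measurable (dunklNormalizedDensity k lam t) := by
  have hkernel : Continuous fun x : ℝ => dunklKernelReal k x lam :=
    Complex.continuous_re.comp
      ((isDunklEigenfunction_dunklKernel hk (lam : ℂ)).entire.continuous.comp
        Complex.continuous_ofReal)
  have hkernel_shift : Measurable fun y : ℝ => dunklKernelReal k (y * √t + lam * t) lam :=
    hkernel.measurable.comp (by fun_prop)
  unfold dunklNormalizedDensity
  fun_prop

end NormalizedDensity

section ConvergenceOfDensities

theorem tendstoInDistribution_of_ae_tendsto_withDensity {ι E Ω' : Type*} {Ω : ι → Type*}
    [MeasurableSpace E] [TopologicalSpace E] [HasOuterApproxClosed E] [BorelSpace E]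
    [∀ i, MeasurableSpace (Ω i)] [MeasurableSpace Ω'] {μ : ∀ i, Measure (Ω i)} {μ' : Measure Ω'}
    [∀ i, IsProbabilityMeasure (μ i)] [IsProbabilityMeasure μ'] {X : ∀ i, Ω i → E} {Z : Ω' → E}
    {l : Filter ι} [l.IsCountablyGenerated] {ν : Measure E} {f : ι → E → ℝ≥0∞} {g : E → ℝ≥0∞}
    (hX : ∀ i, AEMeasurable (X i) (μ i)) (hZ : AEMeasurable Z μ')
    (hf : ∀ i, AEMeasurable (f i) ν) (hXf : ∀ᶠ i in l, (μ i).map (X i) = ν.withDensity (f i))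
    (hZg : μ'.map Z = ν.withDensity g)
    (hfg : ∀ᵐ x ∂ν, Tendsto (fun i => f i x) l (𝓝 (g x))) :
    TendstoInDistribution X l Z μ μ' := by
  refine ⟨hX, hZ, ?_⟩
  rcases l.eq_or_neBot with rfl | hl
  · exact tendsto_bot
  refine tendsto_of_forall_isOpen_le_liminf' fun G hG => ?_
  simp only [ProbabilityMeasure.coe_mk]
  calc μ'.map Z G = ∫⁻ x in G, g x ∂ν := by rw [hZg, withDensity_apply _ hG.measurableSet]
    _ = ∫⁻ x in G, liminf (fun i => f i x) l ∂ν :=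
        lintegral_congr_ae (ae_restrict_of_ae (hfg.mono fun _ hx => hx.liminf_eq.symm))
    _ ≤ liminf (fun i => ∫⁻ x in G, f i x ∂ν) l :=
        lintegral_liminf_le' fun i => (hf i).restrict
    _ = liminf (fun i => (μ i).map (X i) G) l :=
        liminf_congr (hXf.mono fun i hi => by rw [hi, withDensity_apply _ hG.measurableSet])

theorem map_sub_div_withDensity (f : ℝ → ℝ≥0∞) (b : ℝ) {s : ℝ} (hs : s ≠ 0) :
    (volume.withDensity f).map (fun x => (x - b) / s)
      = volume.withDensity fun y => ENNReal.ofReal |s| * f (y * s + b) := by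
  ext A hA
  have hmeas : Measurable fun x : ℝ => (x - b) / s := by fun_prop
  have hleft : Function.LeftInverse (fun x : ℝ => (x - b) / s) fun y => y * s + b :=
    fun y => by simp [hs]
  have hright : Function.RightInverse (fun x : ℝ => (x - b) / s) fun y => y * s + b :=
    fun x => by simp [hs]
  have hpreimage : (fun x : ℝ => (x - b) / s) ⁻¹' A = (fun y => y * s + b) '' A :=
    congrFun (Set.image_eq_preimage_of_inverse hleft hright).symm A
  rw [Measure.map_apply hmeas hA, withDensity_apply _ (hmeas hA), withDensity_apply _ hA,
    hpreimage, lintegral_image_eq_lintegral_abs_deriv_mul hA (f' := fun _ => s)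
      (fun y _ => by simpa using (((hasDerivAt_id y).mul_const s).add_const b).hasDerivWithinAt)
      hleft.injective.injOn]

end ConvergenceOfDensities

section DunklProcess

variable {Ω : Type*} [MeasurableSpace Ω] {P : Measure Ω} [IsProbabilityMeasure P]
  {k lam : ℝ} {X : ℝ≥0 → Ω → ℝ}

theorem IsDunklProcess.measureReal_preimage {x₀ : ℝ} (hX : IsDunklProcess P k lam x₀ X)
    {t : ℝ≥0} (ht : 0 < t) {A : Set ℝ} (hA : MeasurableSet A) :
    P.real (X t ⁻¹' A) = (dunklTransition k lam t x₀).real A := by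
  have hcond := integral_condExp (μ := P) (f := (X t ⁻¹' A).indicator fun _ => (1 : ℝ))
    ((Filtration.natural X fun u => (hX.measurable u).stronglyMeasurable).le 0)
  have hstart : (fun ω => (dunklTransition k lam (t - (0 : ℝ≥0)) (X 0 ω) A).toReal)
      =ᵐ[P] fun _ => (dunklTransition k lam t x₀).real A := by
    filter_upwards [hX.start] with ω hω
    rw [hω, NNReal.coe_zero, sub_zero, Measure.real]
  rw [integral_congr_ae ((hX.markov 0 t ht A hA).trans hstart), integral_const, probReal_univ,
    one_smul, integral_indicator_const _ (hX.measurable t hA), smul_eq_mul, mul_one] at hcond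
  exact hcond.symm

theorem IsDunklProcess.map_eq_dunklTransition {x₀ : ℝ} (hX : IsDunklProcess P k lam x₀ X)
    {t : ℝ≥0} (ht : 0 < t) : P.map (X t) = dunklTransition k lam t x₀ := by
  have huniv : (dunklTransition k lam t x₀).real Set.univ = 1 := by
    rw [← hX.measureReal_preimage ht MeasurableSet.univ, Set.preimage_univ, probReal_univ]
  have : IsFiniteMeasure (dunklTransition k lam t x₀) :=
    ⟨(ENNReal.toReal_pos_iff.mp (one_pos.trans_eq huniv.symm)).2⟩
  ext A hA
  rw [Measure.map_apply (hX.measurable t) hA, ← measureReal_eq_measureReal_iff,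
    hX.measureReal_preimage ht hA]

theorem dunklKernelReal_zero_left (hk : 0 ≤ k) (y : ℝ) : dunklKernelReal k 0 y = 1 := by
  rw [dunklKernelReal, Complex.ofReal_zero, (isDunklEigenfunction_dunklKernel hk (y : ℂ)).at_zero,
    Complex.one_re]

theorem sqrt_mul_dunklTransitionDensity_zero (hk : 0 ≤ k) {t : ℝ} (ht : 0 < t) (y : ℝ) :
    √t * dunklTransitionDensity k lam t 0 (y * √t + t * lam)
      = dunklNormalizedDensity k lam t y := by
  have : 0 < √t := Real.sqrt_pos.mpr ht
  rw [dunklTransitionDensity, dunklNormalizedDensity, zero_div, dunklKernelReal_zero_left hk,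
    dunklKernelReal_zero_left hk, mul_comm t lam, Real.rpow_add ht, ← Real.sqrt_eq_rpow,
    zero_pow two_ne_zero, zero_add, one_mul, div_one]
  field_simp

theorem IsDunklProcess.map_normalized (hk : 0 ≤ k) (hX : IsDunklProcess P k lam 0 X) {t : ℝ≥0}
    (ht : 0 < t) :
    P.map (fun ω => (X t ω - (t : ℝ) * lam) / √(t : ℝ))
      = volume.withDensity fun y => ENNReal.ofReal (dunklNormalizedDensity k lam t y) := by
  have hsqrt : 0 < √(t : ℝ) := Real.sqrt_pos.mpr ht
  have hmap := Measure.map_map (μ := P) (g := fun x => (x - t * lam) / √(t : ℝ)) (by fun_prop)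
    (hX.measurable t)
  rw [hX.map_eq_dunklTransition ht, dunklTransition, map_sub_div_withDensity _ _ hsqrt.ne'] at hmap
  simp only [abs_of_pos hsqrt, ← ENNReal.ofReal_mul hsqrt.le,
    sqrt_mul_dunklTransitionDensity_zero hk (NNReal.coe_pos.mpr ht)] at hmap
  exact hmap.symm

theorem IsDunklProcess.tendstoInDistribution_normalized (hk : 0 < k) (hlam : lam ≠ 0)
    (hX : IsDunklProcess P k lam 0 X) :
    TendstoInDistribution (fun (t : ℝ≥0) ω => (X t ω - (t : ℝ) * lam) / √(t : ℝ)) atTop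
      (id : ℝ → ℝ) (fun _ => P) (gaussianReal 0 1) := by
  refine tendstoInDistribution_of_ae_tendsto_withDensity (ν := volume)
    (f := fun (t : ℝ≥0) y => ENNReal.ofReal (dunklNormalizedDensity k lam t y))
    (g := gaussianPDF 0 1)
    (fun t => (((hX.measurable t).sub_const _).div_const _).aemeasurable) aemeasurable_id
    (fun t => (measurable_dunklNormalizedDensity hk.le t).ennreal_ofReal.aemeasurable)
    ((eventually_gt_atTop 0).mono fun t ht => hX.map_normalized hk.le ht)
    (Measure.map_id.trans (gaussianReal_of_var_ne_zero 0 one_ne_zero)) (ae_of_all _ fun y => ?_)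
  have hpair : Tendsto (fun t : ℝ≥0 => ((t : ℝ), y)) atTop (atTop ×ˢ 𝓝 y) :=
    (NNReal.tendsto_coe_atTop.mpr tendsto_id).prodMk tendsto_const_nhds
  have hdensity := (tendsto_dunklNormalizedDensity hk hlam y).comp hpair
  simp only [Function.comp_def] at hdensity
  exact ENNReal.tendsto_ofReal hdensity

end DunklProcess

theorem mainTheorem10 {Ω : Type*} [MeasurableSpace Ω] (P : Measure Ω) [IsProbabilityMeasure P]
    (k lam : ℝ) (hk : 0 < k) (hlam : lam ≠ 0) (X : ℝ≥0 → Ω → ℝ)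
    (hX : IsDunklProcess P k lam 0 X) :
    TendstoInDistribution (fun (t : ℝ≥0) (ω : Ω) => (X t ω - (t : ℝ) * lam) / √(t : ℝ)) atTop
        (id : ℝ → ℝ) (fun _ => P) (gaussianReal 0 1)
      ∧ (∀ t : ℝ≥0, 0 < t →
          P.map (fun ω => (X t ω - (t : ℝ) * lam) / √(t : ℝ))
            = volume.withDensity
                (fun y : ℝ => ENNReal.ofReal (dunklNormalizedDensity k lam (t : ℝ) y)))
      ∧ TendstoLocallyUniformly (fun (t : ℝ) (y : ℝ) => dunklNormalizedDensity k lam t y)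
          (gaussianPDFReal 0 1) atTop := by
  exact ⟨hX.tendstoInDistribution_normalized hk hlam, fun t ht => hX.map_normalized hk.le ht,
    tendstoLocallyUniformly_dunklNormalizedDensity hk hlam⟩
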